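/- Let $K$ be an ordered field in which every positive element has a square root (an ordered quadratically closed field), let $\overline{K}$ be an algebraic closure of $K$, let $L\subseteq\overline{K}$ be a real closure of $K$ (that is, $K\subseteq L\subseteq \overline K$, $L$ is a real closed field, and its order extends that of $K$), and fix $\sqrt{-1}\in\overline{K}$ with $(\sqrt{-1})^2=-1$. (a) For every $z\in\overline{K}$ there is exactly one pair $(x,y)\in L\times L$ with $z=x+\sqrt{-1}\,y$. Write $\mathrm{Re}(z)=x$ and $\mathrm{Im}(z)=y$ (these depend on $L$ and $\sqrt{-1}$). (b) For $z\in\overline{K}$ with minimal polynomial $X^d+a_{d-1}X^{d-1}+\dots+a_0$ over $K$, where $d$ is not a multiple of the characteristic of $K$ (which is automatic here, as $K$ has characteristic $0$), put $H_K(z)=-a_{d-1}/d\in K$ and $V_K(z)=z-H_K(z)$. If $z$ has degree $2$ over $K$, then $\mathrm{Re}(z)$ and $\mathrm{Im}(z)$ lie in $K$, and $H_K(z)=\mathrm{Re}(z)$ and $V_K(z)=\sqrt{-1}\,\mathrm{Im}(z)$. Hence, for such $z$, $\mathrm{Re}(z)$ and $\mathrm{Im}(z)$ do not depend on the choice of the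 real closure $L$ of $K$ in $\overline{K}$. -/

import Mathlib

/-- An ordered field is quadratically closed (as an ordered field) if every positive element
has a square root in it. -/
def IsOrderedQuadraticallyClosed (K : Type*) [Field K] [LinearOrder K] [IsStrictOrderedRing K] :
    Prop :=
  ∀ a : K, 0 < a → IsSquare a

/-- `L`, an intermediate field of `E / K`, is a real closure of the ordered field `K` in `E`
(used for `E` an algebraic closure of `K`): it is algebraic over `K`, real closed, and its order
extends the order of `K`. -/
def IsRealClosureIn {K E : Type*} [Field K] [LinearOrder K] [IsStrictOrderedRing K]
    [Field E] [Algebra K E] (L : IntermediateField K E) : Prop :=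
  Algebra.IsAlgebraic K L ∧ IsRealClosed L ∧
    ∃ _ : LinearOrder L, IsStrictOrderedRing L ∧
      ∀ a b : K, algebraMap K L a ≤ algebraMap K L b ↔ a ≤ b

/-- An element is `K`-regular if its degree over `K` is not a multiple of the characteristic
of `K`. -/
def IsKRegular (K : Type*) {E : Type*} [Field K] [Field E] [Algebra K E] (z : E) : Prop :=
  ¬ ringChar K ∣ (minpoly K z).natDegree

/-- The `K`-projection (`K`-horizontal component) `H_K(z) = - a_{d-1} / d`, where
`X ^ d + a_{d-1} X ^ (d-1) + ... + a_0` is the minimal polynomial of `z` over `K`.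
It is meaningful for `K`-regular elements (so that `d` is invertible in `K`). -/
noncomputable def horizontalPart (K : Type*) {E : Type*} [Field K] [Field E] [Algebra K E]
    (z : E) : K :=
  -(minpoly K z).coeff ((minpoly K z).natDegree - 1) / ((minpoly K z).natDegree : K)

/-- The `K`-vertical component `V_K(z) = z - H_K(z)`. -/
noncomputable def verticalPart (K : Type*) {E : Type*} [Field K] [Field E] [Algebra K E]
    (z : E) : E :=
  z - algebraMap K E (horizontalPart K z)

open Classical in
/-- The pair `(x, y)` of elements of `L` with `z = x + i * y`
(and the value `0` if there is no such pair). -/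
noncomputable def reImPair {K E : Type*} [Field K] [Field E] [Algebra K E]
    (L : IntermediateField K E) (i z : E) : L × L :=
  if h : ∃ p : L × L, z = (p.1 : E) + i * (p.2 : E) then h.choose else 0

/-- The real part of `z`, relative to `L` and the square root `i` of `-1`. -/
noncomputable def rePart {K E : Type*} [Field K] [Field E] [Algebra K E]
    (L : IntermediateField K E) (i z : E) : L :=
  (reImPair L i z).1

/-- The imaginary part of `z`, relative to `L` and the square root `i` of `-1`. -/
noncomputable def imPart {K E : Type*} [Field K] [Field E] [Algebra K E]
    (L : IntermediateField K E) (i z : E) : L :=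
  (reImPair L i z).2

/-! For (a), existence is the Artin–Schreier argument that `L(i)` is algebraically closed. A finite
Galois extension of a real closed field has 2-power degree; every element of `L(i)` is a square, so
`L(i)` has no quadratic extension and a Galois group over it of 2-power order is trivial. Uniqueness
holds because `i ∉ L`. For (b), completing the square gives `(z - H)^2 = -e^2` with `H = H_K(z)` and
`e ∈ K`, so `z = H ± i e`. These coordinates already lie in `K`, hence in every real closure, and
uniqueness in (a) identifies them with the real and imaginary parts. -/

open IntermediateField in
theorem finrank_eq_one_of_forall_isSquare_of_finrank_eq_two_pow {F N : Type*} [Field F] [Field N]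
    [Algebra F N] [NeZero (2 : F)] [FiniteDimensional F N] [IsGalois F N]
    (hsq : ∀ a : F, IsSquare a) {n : ℕ} (hn : Module.finrank F N = 2 ^ n) :
    Module.finrank F N = 1 := by
  rcases n with _ | m
  · simpa using hn
  exfalso
  have hcard : Nat.card Gal(N/F) = 2 ^ (m + 1) := by rw [IsGalois.card_aut_eq_finrank, hn]
  -- An index 2 subgroup: its fixed field is quadratic over `F`, which the quadratic formula
  -- forbids.
  obtain ⟨H, hH⟩ := Sylow.exists_subgroup_card_pow_prime (G := Gal(N/F)) 2 (n := m)
    (by rw [hcard]; exact pow_dvd_pow 2 m.le_succ)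
  have h2 : Module.finrank F (fixedField H) = 2 := by
    have h := Module.finrank_mul_finrank F (fixedField H) N
    rw [finrank_fixedField_eq_card, hH, hn, pow_succ, mul_comm] at h
    exact Nat.eq_of_mul_eq_mul_left (by positivity) h
  obtain ⟨x, hx, hxF⟩ : ∃ x ∈ fixedField H, x ∉ (⊥ : IntermediateField F N) := by
    by_contra! hle
    have := finrank_eq_one_iff.mpr (le_bot_iff.mp hle)
    omega
  have hint : IsIntegral F x := Algebra.IsIntegral.isIntegral x
  have hint' : IsIntegral F (⟨x, hx⟩ : fixedField H) := Algebra.IsIntegral.isIntegral _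
  have hdvd : (minpoly F x).natDegree ∣ 2 := by
    rw [← h2, ← minpoly_eq (⟨x, hx⟩ : fixedField H)]
    exact minpoly.degree_dvd hint'
  have hdeg1 : (minpoly F x).natDegree ≠ 1 := by
    rw [Ne, minpoly.natDegree_eq_one_iff]
    exact fun ⟨y, hy⟩ => hxF (mem_bot.mpr ⟨y, hy⟩)
  have hdeg : (minpoly F x).natDegree = 2 :=
    ((Nat.dvd_prime Nat.prime_two).mp hdvd).resolve_left hdeg1
  obtain ⟨y, hy⟩ := exists_quadratic_eq_zero (a := (1 : F)) (b := (minpoly F x).coeff 1)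
    (c := (minpoly F x).coeff 0) one_ne_zero (hsq _)
  have hlead : (minpoly F x).coeff 2 = 1 := by
    rw [← hdeg]; exact (minpoly.monic hint).coeff_natDegree
  have hroot : (minpoly F x).IsRoot y := by
    rw [Polynomial.IsRoot, Polynomial.eval_eq_sum_range, hdeg]
    simp only [Finset.sum_range_succ, Finset.sum_range_zero, hlead]
    linear_combination hy
  exact hdeg1 (Polynomial.natDegree_eq_of_degree_eq_some
    (Polynomial.degree_eq_one_of_irreducible_of_root (minpoly.irreducible hint) hroot))

-- The fixed field of a Sylow 2-subgroup has odd degree, so its elements have odd-degree minimal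
-- polynomials. These have roots in `F`, so the fixed field is `F`.
open IntermediateField in
theorem IsRealClosed.finrank_eq_two_pow {F N : Type*} [Field F] [IsRealClosed F] [Field N]
    [Algebra F N] [FiniteDimensional F N] [IsGalois F N] :
    ∃ n, Module.finrank F N = 2 ^ n := by
  let P : Sylow 2 Gal(N/F) := default
  have hodd : Odd (Module.finrank F (fixedField (P : Subgroup Gal(N/F)))) := by
    have h := Module.finrank_mul_finrank F (fixedField (P : Subgroup Gal(N/F))) N
    rw [finrank_fixedField_eq_card, ← IsGalois.card_aut_eq_finrank F N, ← P.card_mul_index,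
      mul_comm] at h
    rw [Nat.eq_of_mul_eq_mul_left Nat.card_pos h, ← Nat.not_even_iff_odd, even_iff_two_dvd]
    exact P.not_dvd_index
  have hbot : fixedField (P : Subgroup Gal(N/F)) = ⊥ := by
    refine le_bot_iff.mp fun x hx => ?_
    have hint : IsIntegral F (⟨x, hx⟩ : fixedField (P : Subgroup Gal(N/F))) :=
      Algebra.IsIntegral.isIntegral _
    obtain ⟨y, hy⟩ := IsRealClosed.exists_isRoot_of_odd_natDegree
      (Odd.of_dvd_nat hodd (minpoly.degree_dvd hint))
    obtain ⟨z, hz⟩ := minpoly.natDegree_eq_one_iff.mp (Polynomial.natDegree_eq_of_degree_eq_some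
      (Polynomial.degree_eq_one_of_irreducible_of_root (minpoly.irreducible hint) hy))
    exact mem_bot.mpr ⟨z, congrArg Subtype.val hz⟩
  refine ⟨(Nat.card Gal(N/F)).factorization 2, ?_⟩
  have h := Module.finrank_mul_finrank F (fixedField (P : Subgroup Gal(N/F))) N
  rw [finrank_eq_one_iff.mpr hbot, one_mul, finrank_fixedField_eq_card] at h
  rw [← h]
  exact P.card_eq_multiplicity

theorem IsRealClosed.exists_sq_eq_add_mul {F E : Type*} [Field F] [LinearOrder F]
    [IsStrictOrderedRing F] [IsRealClosed F] [Field E] [Algebra F E] {i : E} (hi : i ^ 2 = -1)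
    (a b : F) :
    ∃ u v : F, (algebraMap F E u + i * algebraMap F E v) ^ 2 =
      algebraMap F E a + i * algebraMap F E b := by
  obtain ⟨c, hc0, hc⟩ : ∃ c : F, 0 ≤ c ∧ c ^ 2 = a ^ 2 + b ^ 2 := by
    obtain ⟨r, hr⟩ := IsSquare.of_nonneg (by positivity : 0 ≤ a ^ 2 + b ^ 2)
    exact ⟨|r|, abs_nonneg r, by rw [sq_abs, hr, sq]⟩
  have hac : |a| ≤ c := abs_le_of_sq_le_sq (by nlinarith [sq_nonneg b]) hc0
  obtain ⟨h1, h2⟩ := abs_le.mp hac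
  -- Solves `u^2 - v^2 = a`, `u^2 + v^2 = c`; then `2uv = ±b`, and the sign of `v` is adjusted at
  -- the end.
  obtain ⟨u, hu⟩ := IsSquare.of_nonneg (by linarith : 0 ≤ (c + a) / 2)
  obtain ⟨v, hv⟩ := IsSquare.of_nonneg (by linarith : 0 ≤ (c - a) / 2)
  have ha : u ^ 2 - v ^ 2 = a := by linear_combination -hu + hv
  have key (w : F) (hw : w ^ 2 = v ^ 2) (huw : 2 * u * w = b) :
      (algebraMap F E u + i * algebraMap F E w) ^ 2 =
        algebraMap F E a + i * algebraMap F E b := by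
    rw [← ha, ← huw, ← hw]
    simp only [map_sub, map_mul, map_pow, map_ofNat]
    linear_combination algebraMap F E w ^ 2 * hi
  have hb : (2 * u * v) ^ 2 = b ^ 2 := by
    linear_combination -4 * v ^ 2 * hu - 4 * ((c + a) / 2) * hv + hc
  rcases sq_eq_sq_iff_eq_or_eq_neg.mp hb with h | h
  · exact ⟨u, v, key v rfl h⟩
  · exact ⟨u, -v, key (-v) (neg_sq v) (by linear_combination -h)⟩

open IntermediateField in
theorem exists_eq_add_mul_of_mem_adjoin_sqrt_neg_one {F E : Type*} [Field F] [Field E]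
    [Algebra F E] {i : E} (hi : i ^ 2 = -1) {z : E} (hz : z ∈ F⟮i⟯) :
    ∃ x y : F, z = algebraMap F E x + i * algebraMap F E y := by
  have hint : IsIntegral F i := IsIntegral.of_pow two_pos (by
    rw [hi, ← map_one (algebraMap F E), ← map_neg]; exact isIntegral_algebraMap)
  rw [← mem_toSubalgebra, adjoin_simple_toSubalgebra_of_isAlgebraic hint.isAlgebraic] at hz
  induction hz using Algebra.adjoin_induction with
  | mem z hz => exact ⟨0, 1, by simp [Set.mem_singleton_iff.mp hz]⟩
  | algebraMap r => exact ⟨r, 0, by simp⟩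
  | add z w _ _ hz hw =>
    obtain ⟨x, y, rfl⟩ := hz
    obtain ⟨x', y', rfl⟩ := hw
    exact ⟨x + x', y + y', by simp only [map_add]; ring⟩
  | mul z w _ _ hz hw =>
    obtain ⟨x, y, rfl⟩ := hz
    obtain ⟨x', y', rfl⟩ := hw
    refine ⟨x * x' - y * y', x * y' + y * x', ?_⟩
    simp only [map_add, map_sub, map_mul]
    linear_combination algebraMap F E y * algebraMap F E y' * hi

open IntermediateField in
theorem IsRealClosed.exists_eq_add_mul_of_isGalois {F N : Type*} [Field F] [LinearOrder F]
    [IsStrictOrderedRing F] [IsRealClosed F] [Field N] [Algebra F N] [FiniteDimensional F N]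
    [IsGalois F N] {i : N} (hi : i ^ 2 = -1) (z : N) :
    ∃ x y : F, z = algebraMap F N x + i * algebraMap F N y := by
  have hsq (a : F⟮i⟯) : IsSquare a := by
    obtain ⟨x, y, hxy⟩ := exists_eq_add_mul_of_mem_adjoin_sqrt_neg_one hi a.2
    let j : F⟮i⟯ := ⟨i, mem_adjoin_simple_self F i⟩
    have hj : j ^ 2 = -1 := Subtype.ext (by simpa using hi)
    obtain ⟨u, v, huv⟩ := IsRealClosed.exists_sq_eq_add_mul hj x y
    refine ⟨algebraMap F F⟮i⟯ u + j * algebraMap F F⟮i⟯ v, ?_⟩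
    rw [← sq, huv]
    exact Subtype.ext hxy
  obtain ⟨n, hn⟩ := IsRealClosed.finrank_eq_two_pow (F := F) (N := N)
  obtain ⟨m, -, hm⟩ := (Nat.dvd_prime_pow Nat.prime_two).mp
    (hn ▸ Dvd.intro_left _ (Module.finrank_mul_finrank F F⟮i⟯ N))
  -- Makes 2 nonzero in `F⟮i⟯`, as the quadratic formula requires.
  have : CharZero F⟮i⟯ := charZero_of_injective_algebraMap (algebraMap F F⟮i⟯).injective
  have h1 := finrank_eq_one_of_forall_isSquare_of_finrank_eq_two_pow hsq hm
  refine exists_eq_add_mul_of_mem_adjoin_sqrt_neg_one hi ?_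
  rw [finrank_eq_one_iff_eq_top.mp h1]
  exact mem_top

open IntermediateField in
theorem IsRealClosed.exists_eq_add_mul {F E : Type*} [Field F] [LinearOrder F]
    [IsStrictOrderedRing F] [IsRealClosed F] [Field E] [Algebra F E] [IsAlgClosed E]
    [Algebra.IsAlgebraic F E] {i : E} (hi : i ^ 2 = -1) (z : E) :
    ∃ x y : F, z = algebraMap F E x + i * algebraMap F E y := by
  have : IsAlgClosure F E := ⟨inferInstance, inferInstance⟩
  have : Normal F E := IsAlgClosure.normal F E
  have hfin : FiniteDimensional F (adjoin F {i, z}) :=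
    finiteDimensional_adjoin fun x _ => Algebra.IsIntegral.isIntegral x
  -- A finite Galois extension containing both `i` and `z`.
  let N := normalClosure F (adjoin F {i, z}) E
  have : FiniteDimensional F N := inferInstanceAs (FiniteDimensional F (normalClosure F _ E))
  have : IsGalois F N := inferInstanceAs (IsGalois F (normalClosure F _ E))
  have hmem : ∀ x ∈ ({i, z} : Set E), x ∈ N := fun x hx =>
    le_normalClosure _ (subset_adjoin F _ hx)
  obtain ⟨x, y, h⟩ := IsRealClosed.exists_eq_add_mul_of_isGalois (F := F) (N := N)
    (i := ⟨i, hmem i (by simp)⟩) (Subtype.ext (by simpa using hi)) ⟨z, hmem z (by simp)⟩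
  exact ⟨x, y, congrArg Subtype.val h⟩

/-- Otherwise `i` would be a quotient of elements of `L`, making `-1` a square in a semireal field.
-/
theorem eq_and_eq_of_add_mul_eq {K E : Type*} [Field K] [Field E] [Algebra K E]
    {L : IntermediateField K E} [IsSemireal L] {i : E} (hi : i ^ 2 = -1) {x y x' y' : L}
    (h : (x : E) + i * y = x' + i * y') : x = x' ∧ y = y' := by
  have hy : y = y' := by
    by_contra hne
    have hne' : (y : E) - y' ≠ 0 := sub_ne_zero.mpr fun h => hne (Subtype.ext h)
    have hiL : i = (((x' - x) / (y - y') : L) : E) := by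
      push_cast
      rw [eq_div_iff hne']
      linear_combination h
    refine IsSemireal.not_isSumSq_neg_one (R := L) (IsSquare.isSumSq ⟨(x' - x) / (y - y'), ?_⟩)
    apply Subtype.ext
    push_cast at hiL ⊢
    rw [← hiL, ← sq, hi]
  subst hy
  exact ⟨Subtype.ext (by linear_combination h), rfl⟩

theorem IsRealClosureIn.existsUnique_eq_add_mul {K E : Type*} [Field K] [LinearOrder K]
    [IsStrictOrderedRing K] [Field E] [Algebra K E] [IsAlgClosure K E]
    {L : IntermediateField K E} (hL : IsRealClosureIn L) {i : E} (hi : i ^ 2 = -1) (z : E) :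
    ∃! p : L × L, z = (p.1 : E) + i * (p.2 : E) := by
  obtain ⟨-, hrc, _, _, -⟩ := hL
  have : IsAlgClosed E := IsAlgClosure.isAlgClosed K
  have : Algebra.IsAlgebraic K E := IsAlgClosure.isAlgebraic
  have : Algebra.IsAlgebraic L E := Algebra.IsAlgebraic.tower_top (K := K) L
  obtain ⟨x, y, h⟩ := IsRealClosed.exists_eq_add_mul (F := L) hi z
  refine ⟨(x, y), h, fun p hp => ?_⟩
  obtain ⟨h1, h2⟩ := eq_and_eq_of_add_mul_eq hi (hp.symm.trans h)
  exact Prod.ext h1 h2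

theorem IsRealClosureIn.eq_rePart_add_mul_imPart {K E : Type*} [Field K] [LinearOrder K]
    [IsStrictOrderedRing K] [Field E] [Algebra K E] [IsAlgClosure K E]
    {L : IntermediateField K E} (hL : IsRealClosureIn L) {i : E} (hi : i ^ 2 = -1) (z : E) :
    z = (rePart L i z : E) + i * (imPart L i z : E) := by
  have h := (hL.existsUnique_eq_add_mul hi z).exists
  rw [rePart, imPart, reImPair, dif_pos h]
  exact h.choose_spec

theorem IsRealClosureIn.rePart_eq_and_imPart_eq {K E : Type*} [Field K] [LinearOrder K]
    [IsStrictOrderedRing K] [Field E] [Algebra K E] [IsAlgClosure K E]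
    {L : IntermediateField K E} (hL : IsRealClosureIn L) {i : E} (hi : i ^ 2 = -1) {z : E}
    {x y : K} (hz : z = algebraMap K E x + i * algebraMap K E y) :
    (rePart L i z : E) = algebraMap K E x ∧ (imPart L i z : E) = algebraMap K E y := by
  have := hL.2.1
  obtain ⟨h1, h2⟩ := eq_and_eq_of_add_mul_eq (x' := algebraMap K L x) (y' := algebraMap K L y) hi
    ((hL.eq_rePart_add_mul_imPart hi z).symm.trans hz)
  exact ⟨congrArg Subtype.val h1, congrArg Subtype.val h2⟩

theorem IsOrderedQuadraticallyClosed.exists_eq_horizontalPart_add_mul {K E : Type*} [Field K]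
    [LinearOrder K] [IsStrictOrderedRing K] [Field E] [Algebra K E]
    (hK : IsOrderedQuadraticallyClosed K) {i : E} (hi : i ^ 2 = -1) {z : E}
    (hz : (minpoly K z).natDegree = 2) :
    ∃ y : K, z = algebraMap K E (horizontalPart K z) + i * algebraMap K E y := by
  have hint : IsIntegral K z := by
    by_contra h
    simp [minpoly.eq_zero h] at hz
  have hlead : (minpoly K z).coeff 2 = 1 := by
    rw [← hz]; exact (minpoly.monic hint).coeff_natDegree
  set H := horizontalPart K z with hH
  have hb : (minpoly K z).coeff 1 = -2 * H := by
    rw [hH, horizontalPart, hz]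
    push_cast
    ring
  set c := (minpoly K z).coeff 0 with hc
  have hroot : (z - algebraMap K E H) ^ 2 = algebraMap K E (H ^ 2 - c) := by
    have h := minpoly.aeval K z
    rw [Polynomial.aeval_eq_sum_range, hz] at h
    simp only [Finset.sum_range_succ, Finset.sum_range_zero, hlead, hb, ← hc,
      Algebra.smul_def, map_mul, map_neg, map_ofNat, map_one] at h
    simp only [map_sub, map_pow]
    linear_combination h
  -- `H ^ 2 - c` is a quarter of the discriminant; were it nonnegative, it would be a square in `K`
  -- and `z` would have degree 1.
  have hneg : 0 < -(H ^ 2 - c) := by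
    by_contra! hle
    have hs : IsSquare (H ^ 2 - c) := by
      rcases (neg_nonpos.mp hle).eq_or_lt with h0 | h0
      · exact ⟨0, by rw [← h0, mul_zero]⟩
      · exact hK _ h0
    obtain ⟨s, hs⟩ := hs
    rw [hs, ← sq, map_pow] at hroot
    have hmem : z ∈ (algebraMap K E).range := by
      rcases sq_eq_sq_iff_eq_or_eq_neg.mp hroot with h | h
      · exact ⟨H + s, by rw [map_add]; linear_combination -h⟩
      · exact ⟨H - s, by rw [map_sub]; linear_combination -h⟩
    have := minpoly.natDegree_eq_one_iff.mpr hmem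
    omega
  obtain ⟨e, he⟩ := hK _ hneg
  have he' : (z - algebraMap K E H) ^ 2 = (i * algebraMap K E e) ^ 2 := by
    rw [hroot, mul_pow, hi, ← map_pow, sq e, ← he, map_neg]
    ring
  rcases sq_eq_sq_iff_eq_or_eq_neg.mp he' with h | h
  · exact ⟨e, by linear_combination h⟩
  · exact ⟨-e, by rw [map_neg]; linear_combination h⟩

theorem mainTheorem10 {K Kbar : Type*} [Field K] [LinearOrder K] [IsStrictOrderedRing K]
    [Field Kbar] [Algebra K Kbar] [IsAlgClosure K Kbar]
    (hK : IsOrderedQuadraticallyClosed K)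
    (L : IntermediateField K Kbar) (hL : IsRealClosureIn L)
    (i : Kbar) (hi : i ^ 2 = -1) :
    (∀ z : Kbar,
      (∃! p : L × L, z = (p.1 : Kbar) + i * (p.2 : Kbar)) ∧
        z = (rePart L i z : Kbar) + i * (imPart L i z : Kbar)) ∧
    (∀ z : Kbar, (minpoly K z).natDegree = 2 →
      (rePart L i z : Kbar) ∈ Set.range (algebraMap K Kbar) ∧
      (imPart L i z : Kbar) ∈ Set.range (algebraMap K Kbar) ∧
      IsKRegular K z ∧
      algebraMap K Kbar (horizontalPart K z) = (rePart L i z : Kbar) ∧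
      verticalPart K z = i * (imPart L i z : Kbar) ∧
      ∀ L' : IntermediateField K Kbar, IsRealClosureIn L' →
        (rePart L' i z : Kbar) = (rePart L i z : Kbar) ∧
        (imPart L' i z : Kbar) = (imPart L i z : Kbar)) := by
  refine ⟨fun z => ⟨hL.existsUnique_eq_add_mul hi z, hL.eq_rePart_add_mul_imPart hi z⟩,
    fun z hz => ?_⟩
  obtain ⟨y, hy⟩ := hK.exists_eq_horizontalPart_add_mul hi hz
  obtain ⟨hre, him⟩ := hL.rePart_eq_and_imPart_eq hi hy
  refine ⟨⟨_, hre.symm⟩, ⟨_, him.symm⟩, ?_, hre.symm, ?_, fun L' hL' => ?_⟩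
  · rw [IsKRegular, hz, ringChar.eq_zero]
    norm_num
  · rw [verticalPart, him]
    linear_combination hy
  · obtain ⟨hre', him'⟩ := hL'.rePart_eq_and_imPart_eq hi hy
    exact ⟨hre'.trans hre.symm, him'.trans him.symm⟩
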